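/- For integers $\nu\ge 1$ and $n\ge 2$ let $$C_n(\nu)=\sum_{l=1}^{n-1}\cos\frac{2\pi\nu l}{n}\,\csc\frac{\pi l}{n},$$ let $H_k=\sum_{j=1}^{k}\frac1j$ denote the $k$-th harmonic number, let $\gamma$ be Euler's constant, and put $$f(\nu)=-\frac1\pi\left\{4H_{2\nu}-2H_\nu-2\ln\nu-4\ln 2-2\gamma-\frac{1}{12\nu^2}\right\}.$$ Then for every fixed integer $\nu\ge 1$, as $n\to\infty$, $$C_n(\nu)=-\frac{2n}{\pi}\ln\!\left(2\sin\frac{\pi\nu}{n}\right)-\frac{\pi}{12n}\csc^2\frac{\pi\nu}{n}+n f(\nu)+\frac{7\pi^3}{21600\,n^3}+o\!\left(n^{-3}\right).$$ In particular, the difference between $C_n(\nu)$ and the explicit expression on the right-hand side (without the $o(n^{-3})$ term) tends to $0$ as $n\to\infty$. -/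

import Mathlib

open Filter Asymptotics

noncomputable section

/-- The cosecant of a real number. -/
def realCsc (x : ℝ) : ℝ := 1 / Real.sin x

/-- The sum `C_n(ν) = ∑_{l=1}^{n-1} cos (2πνl/n) · csc (πl/n)`. -/
def cosCscSum (n ν : ℕ) : ℝ :=
  ∑ l ∈ Finset.Ico 1 n,
    Real.cos (2 * Real.pi * (ν : ℝ) * (l : ℝ) / (n : ℝ)) * realCsc (Real.pi * (l : ℝ) / (n : ℝ))

/-- `f(ν) = -(1/π) (4 H_{2ν} - 2 H_ν - 2 ln ν - 4 ln 2 - 2γ - 1/(12ν²))`, where `H_k` is the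
`k`-th harmonic number and `γ` is Euler's constant. -/
def linearCoeff (ν : ℕ) : ℝ :=
  -(1 / Real.pi) *
    (4 * (harmonic (2 * ν) : ℝ) - 2 * (harmonic ν : ℝ) - 2 * Real.log (ν : ℝ)
      - 4 * Real.log 2 - 2 * Real.eulerMascheroniConstant - 1 / (12 * (ν : ℝ) ^ 2))

/-- The explicit part of the expansion of `C_n(ν)`, up to and including the term in `n⁻³`. -/
def cosCscExpansion (n ν : ℕ) : ℝ :=
  -(2 * (n : ℝ) / Real.pi) * Real.log (2 * Real.sin (Real.pi * (ν : ℝ) / (n : ℝ)))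
    - Real.pi / (12 * (n : ℝ)) * realCsc (Real.pi * (ν : ℝ) / (n : ℝ)) ^ 2
    + (n : ℝ) * linearCoeff ν
    + 7 * Real.pi ^ 3 / (21600 * (n : ℝ) ^ 3)

end

/-! Passing from `ν` to `ν + 1`, the difference of cosines contributes a factor that cancels the
cosecant, and the remaining sine sum is a single cotangent. Hence C_n(ν) = C_n(0) - 2 ∑_{k<ν}
cot(π(2k+1)/(2n)), where the sum has a fixed number of terms with small arguments.

By csc x = cot(x/2) - cot x and symmetry, C_n(0) = ∑ cot(πl/(2n)). Summing the partial fractions of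
the cotangent over l gives a series of second differences of H_m - 1/(2m) along multiples of n
(`hasSum_cosCscSum_zero`). In the Euler–Maclaurin expansion of H_m the logarithms sum by Wallis'
product and the powers m⁻², m⁻⁴ by ζ(2), ζ(4); the latter produces 7π³/21600. This gives C_n(0) up
to O(n⁻⁴).

Taylor expansion of cot, csc² and log(sin x/x) then shows that the logarithm and csc² terms of the
expansion reproduce all other contributions through n⁻³. -/

/-! ### Euler–Maclaurin estimate for harmonic numbers -/

/-- The error of the Euler–Maclaurin expansion of `H_m` through the term in `m⁻⁴`. -/
noncomputable def harmonicRemainder (m : ℕ) : ℝ :=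
  (harmonic m : ℝ) - 1 / (2 * (m : ℝ)) - Real.log m - Real.eulerMascheroniConstant
    + 1 / (12 * (m : ℝ) ^ 2) - 1 / (120 * (m : ℝ) ^ 4)

theorem tendsto_harmonicRemainder : Tendsto harmonicRemainder atTop (nhds 0) := by
  have h0 : Tendsto (fun m : ℕ => 1 / (m : ℝ)) atTop (nhds 0) := tendsto_one_div_atTop_nhds_zero_nat
  have h := (((Real.tendsto_harmonic_sub_log.sub_const Real.eulerMascheroniConstant).sub
    (h0.const_mul (1 / 2))).add ((h0.pow 2).const_mul (1 / 12))).sub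
      ((h0.pow 4).const_mul (1 / 120))
  norm_num at h
  refine h.congr fun m => ?_
  simp only [harmonicRemainder, one_div, mul_inv]
  ring

/-- In y = 1/(m+1) one has 1/m = y/(1-y) and log m - log(m+1) = log(1-y); all powers of y below the
sixth cancel. The constant 30 = 5·6 suits the comparison with differences of 6/m⁵. -/
theorem abs_harmonicRemainder_succ_sub_le {m : ℕ} (hm : 1 ≤ m) :
    |harmonicRemainder m - harmonicRemainder (m + 1)| ≤ 30 * (1 / ((m : ℝ) + 1)) ^ 6 := by
  have hm' : (1 : ℝ) ≤ m := by exact_mod_cast hm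
  set y : ℝ := 1 / ((m : ℝ) + 1) with hy
  have hy0 : 0 < y := by positivity
  have hy2 : y ≤ 1 / 2 := by
    rw [hy]; exact one_div_le_one_div_of_le (by norm_num) (by linarith)
  have hlog := Real.abs_log_sub_add_sum_range_le (x := y) (by rw [abs_of_pos hy0]; linarith) 5
  rw [abs_of_pos hy0] at hlog
  have hlogeq : Real.log (1 - y) = Real.log m - Real.log ((m : ℝ) + 1) := by
    rw [← Real.log_div (by positivity) (by positivity)]
    congr 1
    rw [hy]; field_simp; ring
  have he : y ^ (5 + 1) / (1 - y) ≤ 2 * y ^ 6 := by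
    rw [div_le_iff₀ (by linarith)]
    have : 0 < y ^ 6 := by positivity
    norm_num
    nlinarith
  have hlog' := hlog.trans he
  simp only [Finset.sum_range_succ, Finset.sum_range_zero] at hlog'
  norm_num at hlog'
  have hz : 1 / (m : ℝ) = y / (1 - y) := by
    rw [eq_div_iff (by linarith), hy]; field_simp; ring
  have hdiff : harmonicRemainder m - harmonicRemainder (m + 1)
      = -(y + y ^ 2 / 2 + y ^ 3 / 3 + y ^ 4 / 4 + y ^ 5 / 5 + Real.log (1 - y))
        + y ^ 6 * (-1 / 6 + y / 2 - 13 / 24 * y ^ 2 + y ^ 3 / 5) / (1 - y) ^ 4 := by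
    have h1y : 1 - y ≠ 0 := by linarith
    have hA : 1 / (2 * (m : ℝ)) = y / (1 - y) / 2 := by rw [← hz]; ring
    have hB : 1 / (12 * (m : ℝ) ^ 2) = (y / (1 - y)) ^ 2 / 12 := by rw [← hz]; ring
    have hC : 1 / (120 * (m : ℝ) ^ 4) = (y / (1 - y)) ^ 4 / 120 := by rw [← hz]; ring
    have hA' : 1 / (2 * ((m : ℝ) + 1)) = y / 2 := by rw [hy]; field_simp
    have hB' : 1 / (12 * ((m : ℝ) + 1) ^ 2) = y ^ 2 / 12 := by rw [hy]; field_simp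
    have hC' : 1 / (120 * ((m : ℝ) + 1) ^ 4) = y ^ 4 / 120 := by rw [hy]; field_simp
    have hH : (harmonic (m + 1) : ℝ) = harmonic m + y := by
      rw [harmonic_succ, hy]; push_cast; ring
    simp only [harmonicRemainder, Nat.cast_add, Nat.cast_one]
    rw [hA, hB, hC, hA', hB', hC', hH, hlogeq]
    field_simp
    ring
  have hrat : |y ^ 6 * (-1 / 6 + y / 2 - 13 / 24 * y ^ 2 + y ^ 3 / 5) / (1 - y) ^ 4|
      ≤ 16 * y ^ 6 := by
    have h4 : (1 / 2 : ℝ) ^ 4 ≤ (1 - y) ^ 4 := pow_le_pow_left₀ (by norm_num) (by linarith) 4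
    have hy6 : 0 < y ^ 6 := by positivity
    have hpoly : |-1 / 6 + y / 2 - 13 / 24 * y ^ 2 + y ^ 3 / 5| ≤ 1 := by
      have h2 : 0 < y ^ 2 := by positivity
      have h2' : y ^ 2 ≤ 1 := pow_le_one₀ hy0.le (by linarith)
      have h3 : 0 < y ^ 3 := by positivity
      have h3' : y ^ 3 ≤ 1 := pow_le_one₀ hy0.le (by linarith)
      rw [abs_le]; constructor <;> linarith
    rw [abs_div, abs_mul, abs_of_pos hy6, abs_of_pos (show 0 < (1 - y) ^ 4 by linarith),
      div_le_iff₀ (by linarith)]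
    nlinarith
  have hy6 : 0 < y ^ 6 := by positivity
  rw [hdiff]
  rw [abs_le] at *
  constructor <;> linarith

/-- The increments are dominated by the telescoping differences 6/k⁵ - 6/(k+1)⁵, and the remainder
tends to 0 at infinity. -/
theorem abs_harmonicRemainder_le {m : ℕ} (hm : 1 ≤ m) :
    |harmonicRemainder m| ≤ 6 / (m : ℝ) ^ 5 := by
  have hstep : ∀ k : ℕ, 1 ≤ k → 30 * (1 / ((k : ℝ) + 1)) ^ 6
      ≤ 6 / (k : ℝ) ^ 5 - 6 / ((k : ℝ) + 1) ^ 5 := by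
    intro k hk
    have hk' : (1 : ℝ) ≤ k := by exact_mod_cast hk
    rw [div_sub_div _ _ (by positivity) (by positivity), one_div, inv_pow, ← div_eq_mul_inv,
      div_le_div_iff₀ (by positivity) (by positivity)]
    have : 30 * (k : ℝ) ^ 5 ≤ 6 * (((k : ℝ) + 1) ^ 5 - k ^ 5) * (k + 1) := by
      have h0 : (0 : ℝ) < k := by linarith
      ring_nf
      nlinarith [pow_pos h0 4, pow_pos h0 3, pow_pos h0 2]
    have h5 : 0 < ((k : ℝ) + 1) ^ 5 := by positivity
    nlinarith
  have hind : ∀ j : ℕ, |harmonicRemainder m - harmonicRemainder (j + m)|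
      ≤ 6 / (m : ℝ) ^ 5 - 6 / ((j + m : ℕ) : ℝ) ^ 5 := by
    intro j
    induction j with
    | zero => simp
    | succ j ih =>
      have h1 := abs_harmonicRemainder_succ_sub_le (m := j + m) (by omega)
      have h2 := hstep (j + m) (by omega)
      have h3 := abs_sub_le (harmonicRemainder m) (harmonicRemainder (j + m))
        (harmonicRemainder (j + m + 1))
      rw [show j + 1 + m = j + m + 1 by ring]
      push_cast at *
      linarith
  have hlim := ((tendsto_add_atTop_iff_nat m).2 tendsto_harmonicRemainder).const_sub
    (harmonicRemainder m)
  rw [sub_zero] at hlim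
  refine le_of_tendsto hlim.abs (Eventually.of_forall fun j => (hind j).trans ?_)
  have : 0 ≤ 6 / ((j + m : ℕ) : ℝ) ^ 5 := by positivity
  linarith

/-! ### Reduction to cotangent sums -/

theorem two_mul_sin_half_mul_sum_sin (a : ℝ) {n : ℕ} (hn : 1 ≤ n) :
    2 * Real.sin (a / 2) * ∑ l ∈ Finset.Ico 1 n, Real.sin (l * a)
      = Real.cos (a / 2) - Real.cos (n * a - a / 2) := by
  induction n, hn using Nat.le_induction with
  | base => simp [show a - a / 2 = a / 2 by ring]
  | succ k hk ih =>
    rw [Finset.sum_Ico_succ_top hk, mul_add, ih]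
    push_cast
    rw [show ((k : ℝ) + 1) * a - a / 2 = k * a + a / 2 by ring, Real.cos_sub, Real.cos_add]
    ring

theorem sum_sin_odd_mul_pi_div {n : ℕ} (k : ℕ) (hk : 2 * k + 1 < 2 * n) :
    ∑ l ∈ Finset.Ico 1 n, Real.sin (l * (Real.pi * (2 * k + 1) / n))
      = Real.cot (Real.pi * (2 * k + 1) / (2 * n)) := by
  have hn : (0 : ℝ) < n := by exact_mod_cast (by omega : 0 < n)
  have h := two_mul_sin_half_mul_sum_sin (Real.pi * (2 * k + 1) / n) (n := n) (by omega)
  rw [show Real.pi * (2 * k + 1) / n / 2 = Real.pi * (2 * k + 1) / (2 * n) by field_simp] at h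
  have hcos : Real.cos (n * (Real.pi * (2 * k + 1) / n) - Real.pi * (2 * k + 1) / (2 * n))
      = -Real.cos (Real.pi * (2 * k + 1) / (2 * n)) := by
    rw [show n * (Real.pi * (2 * k + 1) / n) - Real.pi * (2 * k + 1) / (2 * n)
      = Real.pi - Real.pi * (2 * k + 1) / (2 * n) + k * (2 * Real.pi) by field_simp; ring,
      Real.cos_add_nat_mul_two_pi, Real.cos_pi_sub]
  rw [hcos] at h
  have hk' : (2 * k + 1 : ℝ) < 2 * n := by exact_mod_cast hk
  have hs : 0 < Real.sin (Real.pi * (2 * k + 1) / (2 * n)) := by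
    refine Real.sin_pos_of_pos_of_lt_pi (by positivity) ?_
    rw [div_lt_iff₀ (by positivity)]
    exact mul_lt_mul_of_pos_left hk' Real.pi_pos
  rw [Real.cot_eq_cos_div_sin, eq_div_iff hs.ne']
  linarith

theorem sin_pi_mul_div_ne_zero {n l : ℕ} (hl : 1 ≤ l) (hln : l < n) :
    Real.sin (Real.pi * l / n) ≠ 0 := by
  have hn : (0 : ℝ) < n := by exact_mod_cast (by omega : 0 < n)
  have hl' : (0 : ℝ) < l := by exact_mod_cast hl
  have hln' : (l : ℝ) < n := by exact_mod_cast hln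
  refine (Real.sin_pos_of_pos_of_lt_pi (by positivity) ?_).ne'
  rw [div_lt_iff₀ hn]
  exact mul_lt_mul_of_pos_left hln' Real.pi_pos

theorem cosCscSum_succ_sub {n : ℕ} (k : ℕ) (hk : 2 * k + 1 < 2 * n) :
    cosCscSum n (k + 1) - cosCscSum n k
      = -2 * Real.cot (Real.pi * (2 * k + 1) / (2 * n)) := by
  rw [← sum_sin_odd_mul_pi_div k hk, cosCscSum, cosCscSum, ← Finset.sum_sub_distrib,
    Finset.mul_sum]
  refine Finset.sum_congr rfl fun l hl => ?_
  simp only [Finset.mem_Ico] at hl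
  have hs := sin_pi_mul_div_ne_zero hl.1 hl.2
  rw [← sub_mul, Real.cos_sub_cos, realCsc]
  push_cast
  rw [show (2 * Real.pi * (k + 1) * l / n + 2 * Real.pi * k * l / n) / 2
      = l * (Real.pi * (2 * k + 1) / n) by ring,
    show (2 * Real.pi * (k + 1) * l / n - 2 * Real.pi * k * l / n) / 2
      = Real.pi * l / n by ring, mul_assoc, mul_one_div_cancel hs, mul_one]

theorem cosCscSum_eq_sub_sum_cot {n : ℕ} (ν : ℕ) (hν : ν ≤ n) :
    cosCscSum n ν = cosCscSum n 0
      - 2 * ∑ k ∈ Finset.range ν, Real.cot (Real.pi * (2 * k + 1) / (2 * n)) := by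
  induction ν with
  | zero => simp
  | succ k ih =>
    have h := cosCscSum_succ_sub (n := n) k (by omega)
    rw [Finset.sum_range_succ, mul_add]
    linarith [ih (by omega)]

theorem realCsc_eq_cot_half_sub_cot {x : ℝ} (hx : Real.sin x ≠ 0) :
    realCsc x = Real.cot (x / 2) - Real.cot x := by
  obtain ⟨y, rfl⟩ : ∃ y, x = 2 * y := ⟨x / 2, by ring⟩
  rw [Real.sin_two_mul] at hx
  have h1 : Real.sin y ≠ 0 := fun h => hx (by simp [h])
  have h2 : Real.cos y ≠ 0 := fun h => hx (by simp [h])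
  rw [realCsc, Real.cot_eq_cos_div_sin, Real.cot_eq_cos_div_sin, mul_div_cancel_left₀ _ two_ne_zero,
    Real.sin_two_mul, Real.cos_two_mul]
  field_simp
  ring

theorem sum_cot_pi_mul_div_eq_zero (n : ℕ) :
    ∑ l ∈ Finset.Ico 1 n, Real.cot (Real.pi * l / n) = 0 := by
  rcases Nat.eq_zero_or_pos n with rfl | hn
  · simp
  have hn' : (n : ℝ) ≠ 0 := by positivity
  have h : ∑ l ∈ Finset.Ico 1 n, Real.cot (Real.pi * l / n)
      = ∑ l ∈ Finset.Ico 1 n, -Real.cot (Real.pi * l / n) := by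
    refine Finset.sum_bij' (fun l _ => n - l) (fun l _ => n - l) ?_ ?_ ?_ ?_ ?_
    · intro l hl; simp only [Finset.mem_Ico] at *; omega
    · intro l hl; simp only [Finset.mem_Ico] at *; omega
    · intro l hl; simp only [Finset.mem_Ico] at *; omega
    · intro l hl; simp only [Finset.mem_Ico] at *; omega
    · intro l hl
      simp only [Finset.mem_Ico] at hl
      rw [Nat.cast_sub hl.2.le, show Real.pi * ((n : ℝ) - l) / n = Real.pi - Real.pi * l / n by
        field_simp, Real.cot_eq_cos_div_sin, Real.cot_eq_cos_div_sin, Real.cos_pi_sub,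
        Real.sin_pi_sub]
      ring
  rw [Finset.sum_neg_distrib] at h
  linarith

/-- Each cosecant splits as cot(x/2) - cot x, and the terms cot(πl/n) cancel under l ↦ n - l. -/
theorem cosCscSum_zero_eq_sum_cot (n : ℕ) :
    cosCscSum n 0 = ∑ l ∈ Finset.Ico 1 n, Real.cot (Real.pi * (l / (2 * n))) := by
  have h : cosCscSum n 0 = ∑ l ∈ Finset.Ico 1 n,
      (Real.cot (Real.pi * (l / (2 * n))) - Real.cot (Real.pi * l / n)) := by
    refine Finset.sum_congr rfl fun l hl => ?_
    simp only [Finset.mem_Ico] at hl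
    rw [realCsc_eq_cot_half_sub_cot (sin_pi_mul_div_ne_zero hl.1 hl.2)]
    rw [show Real.pi * (l : ℝ) / n / 2 = Real.pi * (l / (2 * n)) by ring]
    simp
  rw [h, Finset.sum_sub_distrib, sum_cot_pi_mul_div_eq_zero, sub_zero]

/-! ### C_n(0) as a series of harmonic numbers -/

theorem hasSum_cot {x : ℝ} (h0 : 0 < x) (h1 : x < 1) :
    HasSum (fun k : ℕ => 1 / (x - (k + 1)) + 1 / (x + (k + 1)))
      (Real.pi * Real.cot (Real.pi * x) - 1 / x) := by
  have hx : (x : ℂ) ∈ Complex.integerComplement := by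
    rw [Complex.mem_integerComplement_iff]
    rintro ⟨k, hk⟩
    have hk' : (k : ℝ) = x := by exact_mod_cast hk
    rw [← hk'] at h0 h1
    have a : 0 < k := by exact_mod_cast h0
    have b : k < 1 := by exact_mod_cast h1
    omega
  have hs := (summable_cotTerm hx).hasSum
  have := cot_series_rep' hx
  simp only [cotTerm] at hs
  rw [← this] at hs
  rw [← Complex.hasSum_ofReal]
  push_cast
  exact hs

/-- `H_m - 1/(2m)`. -/
noncomputable def harmonicMid (m : ℕ) : ℝ := (harmonic m : ℝ) - 1 / (2 * (m : ℝ))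

theorem sum_Ico_one_div_eq_harmonic_sub (a n : ℕ) (hn : 1 ≤ n) :
    ∑ l ∈ Finset.Ico 1 n, 1 / ((a : ℝ) + l) = harmonic (a + n) - harmonic a - 1 / ((a : ℝ) + n) := by
  induction n, hn using Nat.le_induction with
  | base => simp [harmonic_succ]
  | succ k hk ih =>
    rw [Finset.sum_Ico_succ_top hk, ih, ← add_assoc, harmonic_succ]
    push_cast
    simp only [one_div]
    ring

theorem sum_Ico_one_div_sub_eq_harmonic_sub (a n : ℕ) (hn : 1 ≤ n) (ha : n ≤ a) :
    ∑ l ∈ Finset.Ico 1 n, 1 / ((a : ℝ) - l) = harmonic a - harmonic (a - n) - 1 / (a : ℝ) := by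
  induction n, hn using Nat.le_induction with
  | base =>
    obtain ⟨b, rfl⟩ : ∃ b, a = b + 1 := ⟨a - 1, by omega⟩
    simp [harmonic_succ]
  | succ k hk ih =>
    obtain ⟨b, rfl⟩ : ∃ b, a = b + (k + 1) := ⟨a - (k + 1), by omega⟩
    rw [Finset.sum_Ico_succ_top hk, ih (by omega), show b + (k + 1) - k = b + 1 by omega,
      show b + (k + 1) - (k + 1) = b by omega, harmonic_succ]
    push_cast
    rw [show (b : ℝ) + (k + 1) - k = b + 1 by ring]
    simp only [one_div]
    ring

/-- This telescoping correction replaces H_m by H_m - 1/(2m) in the second differences, which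
removes the odd term of the Euler–Maclaurin expansion. -/
theorem hasSum_one_div_odd_mul_sub {n : ℕ} (hn : 1 ≤ n) :
    HasSum (fun k : ℕ => 1 / (2 * ((2 * k + 1) * n : ℝ)) - 1 / (2 * ((2 * k + 3) * n : ℝ)))
      (1 / (2 * (n : ℝ))) := by
  have hn' : (0 : ℝ) < n := by exact_mod_cast hn
  rw [hasSum_iff_tendsto_nat_of_nonneg]
  · have hsum : ∀ N : ℕ, ∑ k ∈ Finset.range N,
        (1 / (2 * ((2 * k + 1) * n : ℝ)) - 1 / (2 * ((2 * k + 3) * n : ℝ)))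
        = 1 / (2 * (n : ℝ)) - 1 / (2 * ((2 * N + 1) * n : ℝ)) := by
      intro N
      induction N with
      | zero => simp
      | succ N ih =>
        rw [Finset.sum_range_succ, ih]
        push_cast
        rw [show (2 * ((N : ℝ) + 1) + 1) = 2 * N + 3 by ring]
        ring
    simp_rw [hsum]
    have hlim : Tendsto (fun N : ℕ => 1 / (2 * ((2 * N + 1) * n : ℝ))) atTop (nhds 0) := by
      have h := (tendsto_one_div_atTop_nhds_zero_nat (𝕜 := ℝ)).comp
        (tendsto_atTop_mono (f := id) (g := fun N : ℕ => 2 * ((2 * N + 1) * n))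
          (fun N => by simp only [id]; nlinarith) tendsto_id)
      refine h.congr fun N => ?_
      simp
    simpa using hlim.const_sub (1 / (2 * (n : ℝ)))
  · intro k
    rw [sub_nonneg]
    refine one_div_le_one_div_of_le (by positivity) ?_
    nlinarith

/-- Summed over l, the poles ±(k+1) yield reciprocals of the integers on either side of (2k+2)n,
with opposite signs: a second difference of harmonic numbers with step n. The pole at 0 contributes
`harmonicMid n`. -/
theorem hasSum_cosCscSum_zero {n : ℕ} (hn : 1 ≤ n) :
    HasSum (fun k : ℕ => harmonicMid ((2 * k + 1) * n) - 2 * harmonicMid ((2 * k + 2) * n)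
        + harmonicMid ((2 * k + 3) * n))
      (Real.pi / (2 * n) * cosCscSum n 0 - harmonicMid n) := by
  have hn' : (0 : ℝ) < n := by exact_mod_cast hn
  have h1 := hasSum_sum (s := Finset.Ico 1 n)
    (f := fun (l k : ℕ) => 1 / ((l : ℝ) / (2 * n) - (k + 1)) + 1 / ((l : ℝ) / (2 * n) + (k + 1)))
    (a := fun l : ℕ => Real.pi * Real.cot (Real.pi * (l / (2 * n))) - 1 / ((l : ℝ) / (2 * n)))
    (by
      intro l hl
      simp only [Finset.mem_Ico] at hl
      have hl1 : (0 : ℝ) < l := by exact_mod_cast hl.1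
      have hl2 : (l : ℝ) < n := by exact_mod_cast hl.2
      refine hasSum_cot (by positivity) ?_
      rw [div_lt_one (by positivity)]
      linarith)
  have h2 := (h1.mul_left (1 / (2 * (n : ℝ)))).sub (hasSum_one_div_odd_mul_sub hn)
  have hval : 1 / (2 * (n : ℝ)) * ∑ l ∈ Finset.Ico 1 n,
      (Real.pi * Real.cot (Real.pi * (l / (2 * n))) - 1 / ((l : ℝ) / (2 * n))) - 1 / (2 * (n : ℝ))
      = Real.pi / (2 * n) * cosCscSum n 0 - harmonicMid n := by
    have h3 := sum_Ico_one_div_eq_harmonic_sub 0 n hn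
    simp only [Nat.cast_zero, zero_add, harmonic_zero, Rat.cast_zero, sub_zero] at h3
    rw [Finset.sum_sub_distrib, ← Finset.mul_sum, ← cosCscSum_zero_eq_sum_cot, harmonicMid]
    have h4 : ∑ l ∈ Finset.Ico 1 n, 1 / ((l : ℝ) / (2 * n))
        = 2 * n * ∑ l ∈ Finset.Ico 1 n, 1 / (l : ℝ) := by
      rw [Finset.mul_sum]
      exact Finset.sum_congr rfl fun l _ => by rw [one_div_div]; ring
    rw [h4, h3]
    field_simp
    ring
  rw [hval] at h2
  convert! h2 using 2 with k
  have hp := sum_Ico_one_div_eq_harmonic_sub ((2 * k + 2) * n) n hn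
  have hm := sum_Ico_one_div_sub_eq_harmonic_sub ((2 * k + 2) * n) n hn (by nlinarith)
  rw [show (2 * k + 2) * n + n = (2 * k + 3) * n by ring] at hp
  rw [show (2 * k + 2) * n - n = (2 * k + 1) * n by
    rw [Nat.sub_eq_iff_eq_add (by nlinarith)]; ring] at hm
  have hsum : ∑ l ∈ Finset.Ico 1 n,
      (1 / ((l : ℝ) / (2 * n) - (k + 1)) + 1 / ((l : ℝ) / (2 * n) + (k + 1)))
      = 2 * n * (∑ l ∈ Finset.Ico 1 n, 1 / ((((2 * k + 2) * n : ℕ) : ℝ) + l)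
        - ∑ l ∈ Finset.Ico 1 n, 1 / ((((2 * k + 2) * n : ℕ) : ℝ) - l)) := by
    rw [← Finset.sum_sub_distrib, Finset.mul_sum]
    refine Finset.sum_congr rfl fun l hl => ?_
    simp only [Finset.mem_Ico] at hl
    have hl2 : (l : ℝ) < n := by exact_mod_cast hl.2
    push_cast
    rw [show (l : ℝ) / (2 * n) - (k + 1) = -(((2 * k + 2) * n - l) / (2 * n)) by field_simp; ring,
      show (l : ℝ) / (2 * n) + (k + 1) = ((2 * k + 2) * n + l) / (2 * n) by field_simp; ring,
      one_div_neg_eq_neg_one_div, one_div_div, one_div_div]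
    ring
  rw [hsum, hp, hm]
  simp only [harmonicMid]
  push_cast
  rw [show (2 * (k : ℝ) + 2) * n + n = (2 * k + 3) * n by ring]
  field_simp
  ring

/-! ### Summing the expansion of the second differences -/

/-- The even terms sum to z/2^p and the odd ones to z - z/2^p; the shifted odd series lacks its
first term 1. The index-0 term is 0 because 1/0 = 0 and p ≠ 0. -/
theorem hasSum_one_div_pow_second_difference {p : ℕ} (hp : p ≠ 0) {z : ℝ}
    (h : HasSum (fun k : ℕ => 1 / (k : ℝ) ^ p) z) :
    HasSum (fun k : ℕ => 1 / (2 * k + 1 : ℝ) ^ p - 2 * (1 / (2 * k + 2 : ℝ) ^ p)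
      + 1 / (2 * k + 3 : ℝ) ^ p) (2 * z - 4 * (z / 2 ^ p) - 1) := by
  have heven : HasSum (fun k : ℕ => 1 / (2 * k : ℝ) ^ p) (z / 2 ^ p) := by
    convert! h.div_const (2 ^ p) using 2 with k
    rw [mul_pow, div_div, mul_comm]
  have hodd : HasSum (fun k : ℕ => 1 / (2 * k + 1 : ℝ) ^ p) (z - z / 2 ^ p) := by
    have hs : Summable (fun k : ℕ => 1 / (2 * k + 1 : ℝ) ^ p) := by
      have := h.summable.comp_injective (i := fun k : ℕ => 2 * k + 1) (fun a b hab => by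
        simp only at hab; omega)
      refine this.congr fun k => ?_
      simp
    have he : HasSum (fun k : ℕ => 1 / ((2 * k : ℕ) : ℝ) ^ p) (z / 2 ^ p) := by
      simpa using heven
    have ho : HasSum (fun k : ℕ => 1 / ((2 * k + 1 : ℕ) : ℝ) ^ p)
        (∑' k : ℕ, 1 / (2 * k + 1 : ℝ) ^ p) := by
      simpa using hs.hasSum
    have := (he.even_add_odd (f := fun k : ℕ => 1 / (k : ℝ) ^ p) ho).unique h
    rw [show z - z / 2 ^ p = ∑' k : ℕ, 1 / (2 * k + 1 : ℝ) ^ p by linarith]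
    exact hs.hasSum
  have heven1 := (hasSum_nat_add_iff' 1).2 heven
  have hodd1 := (hasSum_nat_add_iff' 1).2 hodd
  have := (hodd.sub (heven1.mul_left 2)).add hodd1
  simp only [Finset.sum_range_one, Nat.cast_zero, mul_zero, zero_pow hp, div_zero, sub_zero,
    zero_add, one_pow, div_one] at this
  convert! this using 1
  · funext k
    push_cast
    rw [show (2 * ((k : ℝ) + 1)) = 2 * k + 2 by ring, show (2 * (k : ℝ) + 2 + 1) = 2 * k + 3 by ring]
  · ring

/-- The weights 1, -2, 1 eliminate log n, and what remains is minus the logarithm of Wallis'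
product. -/
theorem hasSum_log_second_difference {n : ℕ} (hn : 1 ≤ n) :
    HasSum (fun k : ℕ => Real.log ((2 * k + 1) * n) - 2 * Real.log ((2 * k + 2) * n)
      + Real.log ((2 * k + 3) * n)) (-Real.log (Real.pi / 2)) := by
  have hn' : (0 : ℝ) < n := by exact_mod_cast hn
  have hterm : ∀ k : ℕ, Real.log ((2 * k + 1) * n) - 2 * Real.log ((2 * k + 2) * n)
      + Real.log ((2 * k + 3) * n)
      = -Real.log (((2 : ℝ) * k + 2) / (2 * k + 1) * ((2 * k + 2) / (2 * k + 3))) := by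
    intro k
    rw [Real.log_mul (by positivity) (by positivity), Real.log_mul (by positivity) (by positivity),
      Real.log_mul (by positivity) (by positivity), Real.log_mul (by positivity) (by positivity),
      Real.log_div (by positivity) (by positivity), Real.log_div (by positivity) (by positivity)]
    ring
  simp_rw [hterm]
  refine HasSum.neg ?_
  rw [hasSum_iff_tendsto_nat_of_nonneg]
  · have h := Real.tendsto_prod_pi_div_two.log (by positivity)
    refine h.congr fun N => ?_
    rw [Real.log_prod]
    intro k _
    positivity
  · intro k
    refine Real.log_nonneg ?_
    rw [div_mul_div_comm, le_div_iff₀ (by positivity)]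
    nlinarith

theorem harmonicMid_eq (m : ℕ) :
    harmonicMid m = Real.log m + Real.eulerMascheroniConstant - 1 / (12 * (m : ℝ) ^ 2)
      + 1 / (120 * (m : ℝ) ^ 4) + harmonicRemainder m := by
  rw [harmonicMid, harmonicRemainder]; ring

theorem abs_harmonicRemainder_mul_le {n k j : ℕ} (hn : 1 ≤ n) (hj : k + 1 ≤ j) :
    |harmonicRemainder (j * n)| ≤ 6 / (n : ℝ) ^ 5 * (1 / ((k + 1 : ℕ) : ℝ) ^ 2) := by
  have hn' : (0 : ℝ) < n := by exact_mod_cast hn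
  refine (abs_harmonicRemainder_le (Nat.mul_pos (by omega) hn)).trans ?_
  have hj' : ((k + 1 : ℕ) : ℝ) ≤ j := by exact_mod_cast hj
  have hk : (1 : ℝ) ≤ ((k + 1 : ℕ) : ℝ) := by exact_mod_cast (by omega : 1 ≤ k + 1)
  rw [div_mul_div_comm, mul_one]
  refine div_le_div_of_nonneg_left (by norm_num) (by positivity) ?_
  push_cast [mul_pow]
  rw [mul_comm]
  push_cast at hj' hk
  refine mul_le_mul_of_nonneg_right ?_ (by positivity)
  calc ((k : ℝ) + 1) ^ 2 ≤ (k + 1) ^ 5 := pow_le_pow_right₀ hk (by norm_num)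
    _ ≤ (j : ℝ) ^ 5 := pow_le_pow_left₀ (by linarith) hj' 5

theorem abs_cosCscSum_zero_sub_le {n : ℕ} (hn : 1 ≤ n) :
    |cosCscSum n 0 - (2 * n / Real.pi * (Real.log n - Real.log (Real.pi / 2)
        + Real.eulerMascheroniConstant) - Real.pi / (36 * n)
        + 7 * Real.pi ^ 3 / (21600 * (n : ℝ) ^ 3))| ≤ 40 / (n : ℝ) ^ 4 := by
  have hn' : (0 : ℝ) < n := by exact_mod_cast hn
  have hpi := Real.pi_pos
  have hrem := (((hasSum_cosCscSum_zero hn).sub (hasSum_log_second_difference hn)).add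
    ((hasSum_one_div_pow_second_difference two_ne_zero hasSum_zeta_two).mul_left
      (1 / (12 * (n : ℝ) ^ 2)))).sub
    ((hasSum_one_div_pow_second_difference four_ne_zero hasSum_zeta_four).mul_left
      (1 / (120 * (n : ℝ) ^ 4)))
  -- The constant 24 is 6·(1 + 2 + 1), from the weights of the second difference.
  have hbound := (((hasSum_nat_add_iff' 1).2 hasSum_zeta_two).mul_left (24 / (n : ℝ) ^ 5))
  have hle := HasSum.norm_le_of_bounded hrem hbound (fun k => by
    have e : harmonicMid ((2 * k + 1) * n) - 2 * harmonicMid ((2 * k + 2) * n)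
        + harmonicMid ((2 * k + 3) * n) - (Real.log ((2 * k + 1) * n)
          - 2 * Real.log ((2 * k + 2) * n) + Real.log ((2 * k + 3) * n))
        + 1 / (12 * (n : ℝ) ^ 2) * (1 / (2 * k + 1 : ℝ) ^ 2 - 2 * (1 / (2 * k + 2 : ℝ) ^ 2)
          + 1 / (2 * k + 3 : ℝ) ^ 2)
        - 1 / (120 * (n : ℝ) ^ 4) * (1 / (2 * k + 1 : ℝ) ^ 4 - 2 * (1 / (2 * k + 2 : ℝ) ^ 4)
          + 1 / (2 * k + 3 : ℝ) ^ 4)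
        = harmonicRemainder ((2 * k + 1) * n) - 2 * harmonicRemainder ((2 * k + 2) * n)
          + harmonicRemainder ((2 * k + 3) * n) := by
      simp only [harmonicMid_eq]
      push_cast
      simp only [one_div, mul_inv, mul_pow]
      ring
    rw [e, Real.norm_eq_abs]
    have h1 := abs_harmonicRemainder_mul_le (k := k) (j := 2 * k + 1) hn (by omega)
    have h2 := abs_harmonicRemainder_mul_le (k := k) (j := 2 * k + 2) hn (by omega)
    have h3 := abs_harmonicRemainder_mul_le (k := k) (j := 2 * k + 3) hn (by omega)
    rw [show 24 / (n : ℝ) ^ 5 * (1 / ((k + 1 : ℕ) : ℝ) ^ 2)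
      = 4 * (6 / (n : ℝ) ^ 5 * (1 / ((k + 1 : ℕ) : ℝ) ^ 2)) by ring]
    rw [abs_le] at *
    constructor <;> linarith)
  have hn0 := abs_harmonicRemainder_le hn
  rw [Real.norm_eq_abs, harmonicMid_eq] at hle
  simp only [Finset.sum_range_one, Nat.cast_zero] at hle
  set M := 2 * n / Real.pi * (Real.log n - Real.log (Real.pi / 2)
        + Real.eulerMascheroniConstant) - Real.pi / (36 * n)
        + 7 * Real.pi ^ 3 / (21600 * (n : ℝ) ^ 3) with hM
  -- The two -1's from the shifted odd series cancel the n⁻² and n⁻⁴ terms of `harmonicMid n`.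
  have hX : Real.pi / (2 * n) * (cosCscSum n 0 - M) - harmonicRemainder n
      = Real.pi / (2 * n) * cosCscSum n 0 - (Real.log n + Real.eulerMascheroniConstant
        - 1 / (12 * (n : ℝ) ^ 2) + 1 / (120 * (n : ℝ) ^ 4) + harmonicRemainder n)
        - -Real.log (Real.pi / 2)
        + 1 / (12 * (n : ℝ) ^ 2) * (2 * (Real.pi ^ 2 / 6) - 4 * (Real.pi ^ 2 / 6 / 2 ^ 2) - 1)
        - 1 / (120 * (n : ℝ) ^ 4)
          * (2 * (Real.pi ^ 4 / 90) - 4 * (Real.pi ^ 4 / 90 / 2 ^ 4) - 1) := by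
    rw [hM]
    field_simp
    ring
  rw [← hX] at hle
  have hX2 : |Real.pi / (2 * n) * (cosCscSum n 0 - M)|
      ≤ (4 * Real.pi ^ 2 + 6) / (n : ℝ) ^ 5 := by
    -- The term 1/0² is the omitted index 0 of the ζ(2) series and equals 0.
    have : (4 * Real.pi ^ 2 + 6) / (n : ℝ) ^ 5
        = 24 / (n : ℝ) ^ 5 * (Real.pi ^ 2 / 6 - 1 / 0 ^ 2) + 6 / (n : ℝ) ^ 5 := by
      norm_num; ring
    rw [this]
    rw [abs_le] at *
    constructor <;> linarith
  rw [abs_mul, abs_of_pos (show 0 < Real.pi / (2 * n) by positivity)] at hX2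
  have hpi2 : (4 * Real.pi ^ 2 + 6) ≤ 20 * Real.pi := by
    nlinarith [Real.pi_gt_three, Real.pi_lt_four]
  have hfin : Real.pi / (2 * n) * |cosCscSum n 0 - M|
      ≤ Real.pi / (2 * n) * (40 / (n : ℝ) ^ 4) := by
    refine hX2.trans ?_
    rw [show Real.pi / (2 * n) * (40 / (n : ℝ) ^ 4) = 20 * Real.pi / (n : ℝ) ^ 5 by
      field_simp; norm_num]
    gcongr
  exact le_of_mul_le_mul_left hfin (by positivity)

/-! ### Taylor estimates for cot, csc² and log(sin x/x) -/

/-- Imaginary part of the remainder bound for exp(ix); the real part serves the cosine. -/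
theorem abs_sin_sub_taylor_five_le {x : ℝ} (hx : |x| ≤ 1) :
    |Real.sin x - (x - x ^ 3 / 6 + x ^ 5 / 120)| ≤ |x| ^ 7 := by
  have hI : ‖(x : ℂ) * Complex.I‖ ≤ 1 := by simpa using hx
  have h := Complex.exp_bound hI (n := 7) (by norm_num)
  have him := (Complex.abs_im_le_norm _).trans h
  have e : (Complex.exp (x * Complex.I)
      - ∑ m ∈ Finset.range 7, ((x : ℂ) * Complex.I) ^ m / m.factorial).im
      = Real.sin x - (x - x ^ 3 / 6 + x ^ 5 / 120) := by
    have e2 : ∑ m ∈ Finset.range 7, ((x : ℂ) * Complex.I) ^ m / m.factorial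
        = ((1 - x ^ 2 / 2 + x ^ 4 / 24 - x ^ 6 / 720 : ℝ) : ℂ)
          + ((x - x ^ 3 / 6 + x ^ 5 / 120 : ℝ) : ℂ) * Complex.I := by
      simp [Finset.sum_range_succ, Nat.factorial]
      grind [Complex.I_sq]
    rw [Complex.sub_im, Complex.exp_ofReal_mul_I_im, e2, Complex.add_im, Complex.ofReal_im,
      Complex.im_ofReal_mul, Complex.I_im]
    ring
  rw [e] at him
  refine him.trans ?_
  have hp : 0 ≤ |x| ^ 7 := by positivity
  norm_num [Nat.factorial]
  nlinarith

theorem abs_cos_sub_taylor_four_le {x : ℝ} (hx : |x| ≤ 1) :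
    |Real.cos x - (1 - x ^ 2 / 2 + x ^ 4 / 24)| ≤ |x| ^ 6 := by
  have hI : ‖(x : ℂ) * Complex.I‖ ≤ 1 := by simpa using hx
  have h := Complex.exp_bound hI (n := 6) (by norm_num)
  have hre := (Complex.abs_re_le_norm _).trans h
  have e : (Complex.exp (x * Complex.I)
      - ∑ m ∈ Finset.range 6, ((x : ℂ) * Complex.I) ^ m / m.factorial).re
      = Real.cos x - (1 - x ^ 2 / 2 + x ^ 4 / 24) := by
    have e2 : ∑ m ∈ Finset.range 6, ((x : ℂ) * Complex.I) ^ m / m.factorial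
        = ((1 - x ^ 2 / 2 + x ^ 4 / 24 : ℝ) : ℂ)
          + ((x - x ^ 3 / 6 + x ^ 5 / 120 : ℝ) : ℂ) * Complex.I := by
      simp [Finset.sum_range_succ, Nat.factorial]
      grind [Complex.I_sq]
    rw [Complex.sub_re, Complex.exp_ofReal_mul_I_re, e2, Complex.add_re, Complex.ofReal_re,
      Complex.re_ofReal_mul, Complex.I_re]
    ring
  rw [e] at hre
  refine hre.trans ?_
  have hp : 0 ≤ |x| ^ 6 := by positivity
  norm_num [Nat.factorial]
  nlinarith

/-- `sin x = x (1 - x²/6 + x⁴/120 + r x⁶)` with `|r| ≤ 1`. -/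
theorem exists_sin_eq_mul {x : ℝ} (h0 : 0 < x) (h1 : x ≤ 1) :
    ∃ r : ℝ, |r| ≤ 1 ∧ Real.sin x = x * (1 - x ^ 2 / 6 + x ^ 4 / 120 + r * x ^ 6) := by
  have h := abs_sin_sub_taylor_five_le (abs_le.2 ⟨by linarith, h1⟩)
  rw [abs_of_pos h0] at h
  refine ⟨(Real.sin x - (x - x ^ 3 / 6 + x ^ 5 / 120)) / x ^ 7, ?_, ?_⟩
  · rw [abs_div, abs_of_pos (show 0 < x ^ 7 by positivity)]
    exact div_le_one_of_le₀ h (by positivity)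
  · field_simp; ring

/-- `cos x = 1 - x²/2 + x⁴/24 + r x⁶` with `|r| ≤ 1`. -/
theorem exists_cos_eq {x : ℝ} (h0 : 0 < x) (h1 : x ≤ 1) :
    ∃ r : ℝ, |r| ≤ 1 ∧ Real.cos x = 1 - x ^ 2 / 2 + x ^ 4 / 24 + r * x ^ 6 := by
  have h := abs_cos_sub_taylor_four_le (abs_le.2 ⟨by linarith, h1⟩)
  rw [abs_of_pos h0] at h
  refine ⟨(Real.cos x - (1 - x ^ 2 / 2 + x ^ 4 / 24)) / x ^ 6, ?_, ?_⟩
  · rw [abs_div, abs_of_pos (show 0 < x ^ 6 by positivity)]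
    exact div_le_one_of_le₀ h (by positivity)
  · field_simp; ring

theorem three_quarters_mul_le_sin {x : ℝ} (h0 : 0 < x) (h1 : x ≤ 1) :
    3 / 4 * x ≤ Real.sin x := by
  have h := Real.sin_ge_sub_cube h0.le
  nlinarith [mul_nonneg h0.le (show 0 ≤ 1 - x ^ 2 by nlinarith)]

theorem abs_mul_cot_sub_le {x : ℝ} (h0 : 0 < x) (h1 : x ≤ 1) :
    |x * Real.cot x - (1 - x ^ 2 / 3 - x ^ 4 / 45)| ≤ 10 * x ^ 6 := by
  obtain ⟨r, hr, hs⟩ := exists_sin_eq_mul h0 h1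
  obtain ⟨q, hq, hc⟩ := exists_cos_eq h0 h1
  have hge := three_quarters_mul_le_sin h0 h1
  set s := 1 - x ^ 2 / 6 + x ^ 4 / 120 + r * x ^ 6 with hsdef
  have hspos : 3 / 4 ≤ s := by
    rw [hs] at hge; nlinarith
  have hw1 : x ^ 2 ≤ 1 := by nlinarith
  have hw0 : 0 < x ^ 2 := by positivity
  have hx4 : x ^ 4 ≤ 1 := pow_le_one₀ h0.le h1
  have hx40 : 0 < x ^ 4 := by positivity
  -- Over the common denominator s = sin x/x ≥ 3/4, all terms below x⁶ cancel.
  have key : x * Real.cot x - (1 - x ^ 2 / 3 - x ^ 4 / 45)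
      = x ^ 6 * (q - r * (1 - x ^ 2 / 3 - x ^ 4 / 45) - 1 / 1080 + x ^ 2 / 5400) / s := by
    rw [Real.cot_eq_cos_div_sin, hs, hc]
    have : s ≠ 0 := by linarith
    field_simp
    rw [hsdef]
    ring
  have h2 : |q - r * (1 - x ^ 2 / 3 - x ^ 4 / 45) - 1 / 1080 + x ^ 2 / 5400| ≤ 3 := by
    have : |r * (1 - x ^ 2 / 3 - x ^ 4 / 45)| ≤ 1 := by
      rw [abs_mul]
      exact mul_le_one₀ hr (abs_nonneg _) (abs_le.2 ⟨by linarith, by linarith⟩)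
    rw [abs_le] at *
    constructor <;> linarith
  rw [key, abs_div, abs_mul, abs_of_pos (show 0 < x ^ 6 by positivity),
    abs_of_pos (show 0 < s by linarith), div_le_iff₀ (by linarith)]
  have : 0 < x ^ 6 := by positivity
  nlinarith

theorem abs_sq_mul_csc_sq_sub_le {x : ℝ} (h0 : 0 < x) (h1 : x ≤ 1) :
    |x ^ 2 * realCsc x ^ 2 - (1 + x ^ 2 / 3 + x ^ 4 / 15)| ≤ 20 * x ^ 6 := by
  obtain ⟨r, hr, hs⟩ := exists_sin_eq_mul h0 h1
  have hge := three_quarters_mul_le_sin h0 h1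
  set s := 1 - x ^ 2 / 6 + x ^ 4 / 120 + r * x ^ 6 with hsdef
  have hspos : 3 / 4 ≤ s := by
    rw [hs] at hge; nlinarith
  have hw1 : x ^ 2 ≤ 1 := by nlinarith
  have hw0 : 0 < x ^ 2 := by positivity
  have hx4 : x ^ 4 ≤ 1 := pow_le_one₀ h0.le h1
  have hx40 : 0 < x ^ 4 := by positivity
  set t := 1 - x ^ 2 / 6 + x ^ 4 / 120 with ht
  have hs1 : s ≤ 1 := by
    have := Real.sin_le h0.le
    rw [hs] at this
    nlinarith
  have ht0 : 0 ≤ t := by rw [ht]; linarith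
  have ht1 : t ≤ 1 := by rw [ht]; nlinarith
  -- With P = 1 + x²/3 + x⁴/15, the numerator 1 - s²P is (1 - t²P) - (s - t)(s + t)P, where s - t =
  -- r x⁶ and 1 - t²P is a polynomial divisible by x⁶.
  have key : x ^ 2 * realCsc x ^ 2 - (1 + x ^ 2 / 3 + x ^ 4 / 15)
      = x ^ 6 * (-(r * ((s + t) * (1 + x ^ 2 / 3 + x ^ 4 / 15)))
          + (11 / 1080 - (1 / 14400 - 1 / 1080 + 2 / 675) * x ^ 2
            - (1 / 43200 - 1 / 5400) * x ^ 4 - 1 / 216000 * x ^ 6)) / s ^ 2 := by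
    rw [realCsc, hs]
    have : s ≠ 0 := by linarith
    field_simp
    rw [hsdef, ht]
    ring
  have hx6 : x ^ 6 ≤ 1 := pow_le_one₀ h0.le h1
  have hx60 : 0 < x ^ 6 := by positivity
  have h2 : |-(r * ((s + t) * (1 + x ^ 2 / 3 + x ^ 4 / 15)))
          + (11 / 1080 - (1 / 14400 - 1 / 1080 + 2 / 675) * x ^ 2
            - (1 / 43200 - 1 / 5400) * x ^ 4 - 1 / 216000 * x ^ 6)| ≤ 5 := by
    have hP : 0 ≤ (s + t) * (1 + x ^ 2 / 3 + x ^ 4 / 15) := by positivity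
    have hP2 : (s + t) * (1 + x ^ 2 / 3 + x ^ 4 / 15) ≤ 2 * 2 :=
      mul_le_mul (by linarith) (by linarith) (by positivity) (by norm_num)
    have : |r * ((s + t) * (1 + x ^ 2 / 3 + x ^ 4 / 15))| ≤ 1 * 4 := by
      rw [abs_mul, abs_of_nonneg hP]
      exact mul_le_mul hr (by linarith) hP (by norm_num)
    rw [abs_le] at this ⊢
    constructor <;> linarith
  rw [key, abs_div, abs_mul, abs_of_pos hx60,
    abs_of_pos (show 0 < s ^ 2 by positivity), div_le_iff₀ (by positivity)]
  have hsq : 9 / 16 ≤ s ^ 2 := by nlinarith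
  nlinarith

theorem abs_log_sin_div_add_le {x : ℝ} (h0 : 0 < x) (h1 : x ≤ 1) :
    |Real.log (Real.sin x / x) + x ^ 2 / 6 + x ^ 4 / 180| ≤ 20 * x ^ 6 := by
  obtain ⟨r, hr, hs⟩ := exists_sin_eq_mul h0 h1
  have hlow := Real.sin_ge_sub_cube h0.le
  have hupp := Real.sin_le h0.le
  have hw1 : x ^ 2 ≤ 1 := by nlinarith
  have hw0 : 0 < x ^ 2 := by positivity
  have hx60 : 0 < x ^ 6 := by positivity
  set v := x ^ 2 / 6 - x ^ 4 / 120 - r * x ^ 6 with hv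
  have hsv : Real.sin x / x = 1 - v := by
    rw [hs]; field_simp; rw [hv]; ring
  have hsv' : Real.sin x = x * (1 - v) := by
    rw [← hsv]; field_simp
  have hv0 : 0 ≤ v := by
    rw [hsv'] at hupp; nlinarith
  have hv1 : v ≤ x ^ 2 / 6 := by
    rw [hsv'] at hlow
    have : x * v ≤ x * (x ^ 2 / 6) := by linarith
    exact le_of_mul_le_mul_left this h0
  have hlog := Real.abs_log_sub_add_sum_range_le (x := v) (by rw [abs_of_nonneg hv0]; linarith) 2
  rw [abs_of_nonneg hv0] at hlog
  have he : v ^ (2 + 1) / (1 - v) ≤ x ^ 6 := by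
    rw [div_le_iff₀ (by linarith)]
    have : v ^ 3 ≤ (x ^ 2 / 6) ^ 3 := pow_le_pow_left₀ hv0 hv1 3
    norm_num
    nlinarith
  have hlog' := hlog.trans he
  simp only [Finset.sum_range_succ, Finset.sum_range_zero] at hlog'
  norm_num at hlog'
  -- Chosen so that v = x²/6 + x⁴m, which makes the factor x⁶ in -v - v²/2 + x²/6 + x⁴/180 explicit.
  set m := -(1 / 120) - r * x ^ 2 with hm
  have hrx : |r * x ^ 2| ≤ 1 := by
    rw [abs_mul, abs_of_pos hw0]; exact mul_le_one₀ hr hw0.le hw1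
  have hm2 : |m| ≤ 2 := by
    rw [abs_le] at hrx ⊢; constructor <;> rw [hm] <;> linarith
  have hmm : x ^ 2 * m ^ 2 ≤ 4 := by
    have : m ^ 2 ≤ 2 ^ 2 := sq_le_sq.2 (by simpa using hm2)
    nlinarith [sq_nonneg m]
  have hmm0 : 0 ≤ x ^ 2 * m ^ 2 := by positivity
  have hid : -v - v ^ 2 / 2 + x ^ 2 / 6 + x ^ 4 / 180
      = x ^ 6 * (r - m / 6 - x ^ 2 * m ^ 2 / 2) := by
    have : v = x ^ 2 / 6 + x ^ 4 * m := by rw [hv, hm]; ring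
    rw [this, hm]; ring
  have hb : |-v - v ^ 2 / 2 + x ^ 2 / 6 + x ^ 4 / 180| ≤ x ^ 6 * 5 := by
    rw [hid, abs_mul, abs_of_pos hx60]
    refine mul_le_mul_of_nonneg_left ?_ hx60.le
    rw [abs_le] at hr hm2 ⊢; constructor <;> linarith
  rw [hsv]
  rw [abs_le] at hb hlog' ⊢
  constructor <;> linarith

/-! ### The finite cotangent sum -/

theorem sum_range_one_div_odd (ν : ℕ) :
    ∑ k ∈ Finset.range ν, 1 / (2 * (k : ℝ) + 1) = harmonic (2 * ν) - (harmonic ν : ℝ) / 2 := by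
  induction ν with
  | zero => simp
  | succ m ih =>
    rw [Finset.sum_range_succ, ih, show 2 * (m + 1) = 2 * m + 1 + 1 by ring, harmonic_succ,
      harmonic_succ, harmonic_succ]
    push_cast
    field_simp
    ring

theorem sum_range_odd (ν : ℕ) : ∑ k ∈ Finset.range ν, (2 * (k : ℝ) + 1) = (ν : ℝ) ^ 2 := by
  induction ν with
  | zero => simp
  | succ m ih => rw [Finset.sum_range_succ, ih]; push_cast; ring

theorem sum_range_odd_pow_three (ν : ℕ) :
    ∑ k ∈ Finset.range ν, (2 * (k : ℝ) + 1) ^ 3 = (ν : ℝ) ^ 2 * (2 * (ν : ℝ) ^ 2 - 1) := by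
  induction ν with
  | zero => simp
  | succ m ih => rw [Finset.sum_range_succ, ih]; push_cast; ring

theorem abs_cot_sub_le {x : ℝ} (h0 : 0 < x) (h1 : x ≤ 1) :
    |Real.cot x - (1 / x - x / 3 - x ^ 3 / 45)| ≤ 10 * x ^ 5 := by
  have h := abs_mul_cot_sub_le h0 h1
  have e : x * Real.cot x - (1 - x ^ 2 / 3 - x ^ 4 / 45)
      = x * (Real.cot x - (1 / x - x / 3 - x ^ 3 / 45)) := by
    field_simp
  rw [e, abs_mul, abs_of_pos h0] at h
  refine le_of_mul_le_mul_left (h.trans (le_of_eq ?_)) h0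
  ring

theorem abs_sum_cot_sub_le {n ν : ℕ} (hν : 1 ≤ ν) (hn : 4 * ν ≤ n) :
    |∑ k ∈ Finset.range ν, Real.cot (Real.pi * (2 * k + 1) / (2 * n))
      - (2 * n / Real.pi * (harmonic (2 * ν) - (harmonic ν : ℝ) / 2)
        - Real.pi * (ν : ℝ) ^ 2 / (6 * n)
        - Real.pi ^ 3 * ((ν : ℝ) ^ 2 * (2 * (ν : ℝ) ^ 2 - 1)) / (360 * (n : ℝ) ^ 3))|
      ≤ ν * (10 * (Real.pi * ν / n) ^ 5) := by
  have hn' : (0 : ℝ) < n := by exact_mod_cast (by omega : 0 < n)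
  -- Since π < 4 ≤ n/ν, every cotangent argument stays in (0, 1].
  have hx1 : Real.pi * ν / n ≤ 1 := by
    rw [div_le_one hn']
    have : (4 * ν : ℝ) ≤ n := by exact_mod_cast hn
    nlinarith [Real.pi_lt_four, (Nat.cast_nonneg ν : (0 : ℝ) ≤ ν)]
  have hmain : 2 * n / Real.pi * (harmonic (2 * ν) - (harmonic ν : ℝ) / 2)
        - Real.pi * (ν : ℝ) ^ 2 / (6 * n)
        - Real.pi ^ 3 * ((ν : ℝ) ^ 2 * (2 * (ν : ℝ) ^ 2 - 1)) / (360 * (n : ℝ) ^ 3)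
      = ∑ k ∈ Finset.range ν, (1 / (Real.pi * (2 * k + 1) / (2 * n))
        - Real.pi * (2 * k + 1) / (2 * n) / 3 - (Real.pi * (2 * k + 1) / (2 * n)) ^ 3 / 45) := by
    rw [← sum_range_one_div_odd, ← sum_range_odd_pow_three, ← sum_range_odd]
    simp only [Finset.mul_sum, Finset.sum_div, ← Finset.sum_sub_distrib]
    refine Finset.sum_congr rfl fun k _ => ?_
    have : (2 * (k : ℝ) + 1) ≠ 0 := by positivity
    field_simp
    ring
  rw [hmain, ← Finset.sum_sub_distrib]
  refine (Finset.abs_sum_le_sum_abs _ _).trans ?_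
  have hb : ∀ k ∈ Finset.range ν, |Real.cot (Real.pi * (2 * k + 1) / (2 * n))
      - (1 / (Real.pi * (2 * k + 1) / (2 * n)) - Real.pi * (2 * k + 1) / (2 * n) / 3
        - (Real.pi * (2 * k + 1) / (2 * n)) ^ 3 / 45)| ≤ 10 * (Real.pi * ν / n) ^ 5 := by
    intro k hk
    have hk' : (k : ℝ) + 1 ≤ ν := by exact_mod_cast Finset.mem_range.1 hk
    have hle : Real.pi * (2 * k + 1) / (2 * n) ≤ Real.pi * ν / n := by
      rw [div_le_div_iff₀ (by positivity) hn']
      have : Real.pi * (2 * k + 1) ≤ Real.pi * (2 * ν) := by gcongr; linarith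
      nlinarith
    have hpos : 0 < Real.pi * (2 * k + 1) / (2 * n) := by positivity
    refine (abs_cot_sub_le hpos (hle.trans hx1)).trans ?_
    gcongr
  simpa using Finset.sum_le_sum hb

/-! ### Assembly of the expansion -/

theorem abs_cosCscSum_sub_expansion_le {n ν : ℕ} (hν : 1 ≤ ν) (hn : 4 * ν ≤ n) :
    |cosCscSum n ν - cosCscExpansion n ν| ≤ 40 / (n : ℝ) ^ 4
      + 2 * (ν * (10 * (Real.pi * ν / n) ^ 5)) + 2 * n / Real.pi * (20 * (Real.pi * ν / n) ^ 6)
      + n / (12 * Real.pi * (ν : ℝ) ^ 2) * (20 * (Real.pi * ν / n) ^ 6) := by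
  have hn' : (0 : ℝ) < n := by exact_mod_cast (by omega : 0 < n)
  have hν' : (0 : ℝ) < ν := by exact_mod_cast hν
  have hpi := Real.pi_pos
  have hx1 : Real.pi * ν / n ≤ 1 := by
    rw [div_le_one hn']
    have : (4 * ν : ℝ) ≤ n := by exact_mod_cast hn
    nlinarith [Real.pi_lt_four]
  have hx0 : 0 < Real.pi * ν / n := by positivity
  have hzero := abs_cosCscSum_zero_sub_le (n := n) (by omega)
  have hcot := abs_sum_cot_sub_le hν hn
  have hlog := abs_log_sin_div_add_le hx0 hx1
  have hcsc := abs_sq_mul_csc_sq_sub_le hx0 hx1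
  have hsin : 0 < Real.sin (Real.pi * ν / n) :=
    Real.sin_pos_of_pos_of_lt_pi hx0 (by linarith [Real.pi_gt_three])
  have hlogeq : Real.log (2 * Real.sin (Real.pi * ν / n)) = Real.log 2 + Real.log Real.pi
      + Real.log ν - Real.log n + Real.log (Real.sin (Real.pi * ν / n) / (Real.pi * ν / n)) := by
    rw [Real.log_mul two_ne_zero hsin.ne', Real.log_div hsin.ne' hx0.ne',
      Real.log_div (by positivity) hn'.ne', Real.log_mul hpi.ne' hν'.ne']
    ring
  have hlogpi : Real.log (Real.pi / 2) = Real.log Real.pi - Real.log 2 :=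
    Real.log_div hpi.ne' two_ne_zero
  have hsum := cosCscSum_eq_sub_sum_cot (n := n) ν (by omega)
  rw [hlogpi] at hzero
  set S := ∑ k ∈ Finset.range ν, Real.cot (Real.pi * (2 * k + 1) / (2 * n))
  set L := Real.log (Real.sin (Real.pi * ν / n) / (Real.pi * ν / n))
  set Q := realCsc (Real.pi * ν / n)
  set C := cosCscSum n 0
  set E1 := C - (2 * n / Real.pi * (Real.log n - (Real.log Real.pi - Real.log 2)
        + Real.eulerMascheroniConstant) - Real.pi / (36 * n)
        + 7 * Real.pi ^ 3 / (21600 * (n : ℝ) ^ 3)) with hE1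
  set E2 := S - (2 * n / Real.pi * (harmonic (2 * ν) - (harmonic ν : ℝ) / 2)
        - Real.pi * (ν : ℝ) ^ 2 / (6 * n)
        - Real.pi ^ 3 * ((ν : ℝ) ^ 2 * (2 * (ν : ℝ) ^ 2 - 1)) / (360 * (n : ℝ) ^ 3)) with hE2
  set E3 := L + (Real.pi * ν / n) ^ 2 / 6 + (Real.pi * ν / n) ^ 4 / 180 with hE3
  set E4 := (Real.pi * ν / n) ^ 2 * Q ^ 2
    - (1 + (Real.pi * ν / n) ^ 2 / 3 + (Real.pi * ν / n) ^ 4 / 15) with hE4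
  -- As π/(12n) = n/(12πν²)·(πν/n)², the leading part of the csc² term cancels the 1/(12ν²) in f(ν).
  -- The other main terms cancel as well, leaving only the four errors.
  have key : cosCscSum n ν - cosCscExpansion n ν
      = E1 - 2 * E2 + 2 * n / Real.pi * E3 + n / (12 * Real.pi * (ν : ℝ) ^ 2) * E4 := by
    rw [hsum, cosCscExpansion, hlogeq, linearCoeff, hE1, hE2, hE3, hE4]
    field_simp
    ring
  have h3 : |2 * n / Real.pi * E3| ≤ 2 * n / Real.pi * (20 * (Real.pi * ν / n) ^ 6) := by
    rw [abs_mul, abs_of_pos (by positivity)]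
    gcongr
  have h4 : |n / (12 * Real.pi * (ν : ℝ) ^ 2) * E4|
      ≤ n / (12 * Real.pi * (ν : ℝ) ^ 2) * (20 * (Real.pi * ν / n) ^ 6) := by
    rw [abs_mul, abs_of_pos (by positivity)]
    gcongr
  rw [key]
  rw [abs_le] at hzero hcot h3 h4 ⊢
  constructor <;> linarith

theorem isBigO_cosCscSum_sub_expansion {ν : ℕ} (hν : 1 ≤ ν) :
    (fun n : ℕ => cosCscSum n ν - cosCscExpansion n ν) =O[atTop]
      (fun n : ℕ => 1 / (n : ℝ) ^ 4) := by
  have hν' : (0 : ℝ) < ν := by exact_mod_cast hν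
  have hpi := Real.pi_pos
  refine IsBigO.of_bound (40 + 2 * (ν * (10 * (Real.pi * ν) ^ 5))
    + 2 / Real.pi * (20 * (Real.pi * ν) ^ 6)
    + 1 / (12 * Real.pi * (ν : ℝ) ^ 2) * (20 * (Real.pi * ν) ^ 6)) ?_
  filter_upwards [eventually_ge_atTop (4 * ν)] with n hn
  have hn1 : (1 : ℝ) ≤ n := by exact_mod_cast (by omega : 1 ≤ n)
  have hn0 : (0 : ℝ) < n := by linarith
  have h5 : 1 / (n : ℝ) ^ 5 ≤ 1 / (n : ℝ) ^ 4 :=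
    one_div_le_one_div_of_le (by positivity) (pow_le_pow_right₀ hn1 (by norm_num))
  rw [Real.norm_eq_abs, Real.norm_of_nonneg (by positivity)]
  refine (abs_cosCscSum_sub_expansion_le hν hn).trans ?_
  -- Apart from the first, every term is a constant multiple of n⁻⁵.
  have e : 40 / (n : ℝ) ^ 4
      + 2 * (ν * (10 * (Real.pi * ν / n) ^ 5)) + 2 * n / Real.pi * (20 * (Real.pi * ν / n) ^ 6)
      + n / (12 * Real.pi * (ν : ℝ) ^ 2) * (20 * (Real.pi * ν / n) ^ 6)
      = 40 * (1 / (n : ℝ) ^ 4) + (2 * (ν * (10 * (Real.pi * ν) ^ 5))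
    + 2 / Real.pi * (20 * (Real.pi * ν) ^ 6)
    + 1 / (12 * Real.pi * (ν : ℝ) ^ 2) * (20 * (Real.pi * ν) ^ 6)) * (1 / (n : ℝ) ^ 5) := by
    field_simp
    ring
  rw [e, add_assoc 40, add_assoc 40, add_mul 40]
  gcongr

theorem mainTheorem9 (ν : ℕ) (hν : 1 ≤ ν) :
    (fun n : ℕ => cosCscSum n ν - cosCscExpansion n ν) =o[atTop] (fun n : ℕ => 1 / (n : ℝ) ^ 3) ∧
    Tendsto (fun n : ℕ => cosCscSum n ν - cosCscExpansion n ν) atTop (nhds 0) := by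
  have h0 : Tendsto (fun n : ℕ => 1 / (n : ℝ)) atTop (nhds 0) := tendsto_one_div_atTop_nhds_zero_nat
  have h43 : (fun n : ℕ => 1 / (n : ℝ) ^ 4) =o[atTop] (fun n : ℕ => 1 / (n : ℝ) ^ 3) := by
    have h := ((isLittleO_one_iff ℝ).2 h0).mul_isBigO
      (isBigO_refl (fun n : ℕ => 1 / (n : ℝ) ^ 3) atTop)
    refine h.congr (fun n => ?_) fun n => one_mul _
    rw [one_div_mul_one_div, ← pow_succ']
  have hlit := (isBigO_cosCscSum_sub_expansion hν).trans_isLittleO h43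
  refine ⟨hlit, hlit.isBigO.trans_tendsto ?_⟩
  simpa using h0.pow 3
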